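/- Let $\mathcal H$ be a separable infinite-dimensional complex Hilbert space, $\mathfrak B(\mathcal H)$ the algebra of bounded operators on $\mathcal H$ with the operator norm $\|\cdot\|$, and $G$ a positive (semidefinite) self-adjoint operator on $\mathcal H$ with dense domain $\mathcal D(G)$ such that $\inf\{\|G\varphi\| : \varphi\in\mathcal D(G),\ \|\varphi\|=1\}=0$. For $E>0$ and $A\in\mathfrak B(\mathcal H)$ put $$\|A\|^G_E=\sup\bigl\{\|A\varphi\| : \varphi\in\mathcal H,\ \|\varphi\|=1,\ \langle\varphi|G|\varphi\rangle\le E\bigr\},$$ where $\langle\varphi|G|\varphi\rangle=\|\sqrt G\varphi\|^2$ if $\varphi\in\mathcal D(\sqrt G)$ and $\langle\varphi|G|\varphi\rangle=+\infty$ otherwise. Call $G$ discrete if there are an orthonormal basis $(\tau_k)_{k\ge0}$ of $\mathcal H$ and a nondecreasing sequence $(E_k)_{k\ge0}$ of real numbers tending to $+\infty$ such that $\mathcal D(G)=\{\varphi : \sum_k E_k^2|\langle\tau_k|\varphi\rangle|^2<+\infty\}$ and $G\varphi=\sum_k E_k\langle\tau_k|\varphi\rangle\tau_k$ for $\varphi\in\mathcal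 D(G)$. Then for every $E>0$: (A) The norm $\|\cdot\|^G_E$ is equivalent to the operator norm $\|\cdot\|$ on $\mathfrak B(\mathcal H)$ if and only if $G$ is bounded. (B) The norm $\|\cdot\|^G_E$ generates the strong operator topology on bounded subsets of $\mathfrak B(\mathcal H)$ (that is, on every subset bounded in the operator norm, the topology of the metric $\|A-B\|^G_E$ coincides with the strong operator topology) if and only if $G$ is an unbounded discrete operator. -/

import Mathlib

open scoped InnerProductSpace

noncomputable section

namespace OperatorENorm

variable {H : Type*} [NormedAddCommGroup H] [InnerProductSpace ℂ H] [CompleteSpace H]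

/-- A positive (semidefinite) self-adjoint operator on `H`, possibly unbounded, with dense domain. -/
structure IsPositiveSelfAdjoint (T : H →ₗ.[ℂ] H) : Prop where
  dense : Dense (T.domain : Set H)
  selfAdjoint : IsSelfAdjoint T
  nonneg : ∀ x : T.domain, 0 ≤ (⟪(x : H), T x⟫_ℂ).re

/-- `S` is a positive square root of `G`: it is positive and self-adjoint, and `S ∘ S = G` as
unbounded operators, that is, the domain of `G` is the set of those `x` in the domain of `S`
for which `S x` is in the domain of `S`, and `G x = S (S x)` for these `x`. -/
structure IsPositiveSqrt (S G : H →ₗ.[ℂ] H) : Prop where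
  pos : IsPositiveSelfAdjoint S
  sq : ∀ x y : H, (x, y) ∈ G.graph ↔ ∃ z : H, (x, z) ∈ S.graph ∧ (z, y) ∈ S.graph

/-- The positive square root `√G` of a positive self-adjoint operator `G`. -/
def sqrtOp (G : H →ₗ.[ℂ] H) : H →ₗ.[ℂ] H :=
  Classical.epsilon fun S => IsPositiveSqrt S G

/-- The resolvent `B = (1 + G)⁻¹` of a positive self-adjoint operator. -/
theorem IsPositiveSelfAdjoint.exists_resolvent {G : H →ₗ.[ℂ] H} (hG : IsPositiveSelfAdjoint G) :
    ∃ B : H →L[ℂ] H, B.IsPositive ∧ (1 - B).IsPositive ∧ Function.Injective B ∧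
      ∀ x y : H, (x, y) ∈ G.graph ↔ x = B (x + y) := by
  have hadj : G.adjoint = G := hG.selfAdjoint
  have hpos : ∀ x y : H, (x, y) ∈ G.graph → 0 ≤ (⟪x, y⟫_ℂ).re := by
    intro x y h
    obtain ⟨u, rfl, rfl⟩ := (LinearPMap.mem_graph_iff G).1 h
    exact hG.nonneg u
  have hsym : ∀ x y x' y' : H, (x, y) ∈ G.graph → (x', y') ∈ G.graph →
      ⟪y, x'⟫_ℂ = ⟪x, y'⟫_ℂ := by
    intro x y x' y' h h'
    rw [← hadj, LinearPMap.adjoint_graph_eq_graph_adjoint hG.dense,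
      Submodule.mem_adjoint_iff] at h'
    exact sub_eq_zero.1 (h' x y h)
  have hle : ∀ x y : H, (x, y) ∈ G.graph → ‖x‖ ≤ ‖x + y‖ := by
    intro x y h
    rcases eq_or_ne x 0 with rfl | hx
    · simp
    have h1 : ‖x‖ ^ 2 ≤ (⟪x, x + y⟫_ℂ).re := by
      have h2 : (⟪x, x⟫_ℂ).re = ‖x‖ ^ 2 := inner_self_eq_norm_sq (𝕜 := ℂ) x
      rw [inner_add_right, Complex.add_re, h2]
      linarith [hpos x y h]
    have h2 : (⟪x, x + y⟫_ℂ).re ≤ ‖x‖ * ‖x + y‖ := re_inner_le_norm (𝕜 := ℂ) x (x + y)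
    have h3 : 0 < ‖x‖ := norm_pos_iff.2 hx
    nlinarith
  let L : G.graph →L[ℂ] H :=
    (ContinuousLinearMap.fst ℂ H H + ContinuousLinearMap.snd ℂ H H).comp G.graph.subtypeL
  have hL : ∀ p : G.graph, L p = (p : H × H).1 + (p : H × H).2 := fun p => rfl
  have hcl : IsClosed (G.graph : Set (H × H)) := hG.selfAdjoint.isClosed
  have : CompleteSpace G.graph := hcl.completeSpace_coe
  have hanti : AntilipschitzWith 2 L := by
    refine AddMonoidHomClass.antilipschitz_of_bound L fun p => ?_
    obtain ⟨⟨x, y⟩, h⟩ := p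
    have h1 := hle x y h
    have h2 : ‖y‖ ≤ ‖x + y‖ + ‖x‖ := by
      have := norm_sub_le (x + y) x
      simpa using this
    rw [hL]
    change max ‖x‖ ‖y‖ ≤ _
    refine max_le ?_ ?_
    · push_cast; linarith [norm_nonneg (x + y)]
    · push_cast; linarith
  have hrc : IsClosed (L.range : Set H) := by
    have h0 : (L.range : Set H) = Set.range L := LinearMap.coe_range _
    rw [h0]
    exact hanti.isClosed_range L.uniformContinuous
  have hsurj : L.range = ⊤ := by
    have : CompleteSpace L.range := hrc.completeSpace_coe
    rw [← Submodule.orthogonal_eq_bot_iff, Submodule.eq_bot_iff]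
    intro y hy
    rw [Submodule.mem_orthogonal] at hy
    have h1 : (y, -y) ∈ G.graph := by
      rw [← hadj, LinearPMap.adjoint_graph_eq_graph_adjoint hG.dense, Submodule.mem_adjoint_iff]
      intro a b hab
      have := hy (a + b) ⟨⟨(a, b), hab⟩, rfl⟩
      rw [inner_add_left] at this
      rw [inner_neg_right, sub_neg_eq_add, add_comm]
      exact this
    have h2 := hle _ _ h1
    simpa using h2
  have hinj : L.ker = ⊥ := LinearMap.ker_eq_bot.2 hanti.injective
  let e := ContinuousLinearEquiv.ofBijective L hinj hsurj
  let B : H →L[ℂ] H :=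
    ((ContinuousLinearMap.fst ℂ H H).comp G.graph.subtypeL).comp (e.symm : H →L[ℂ] G.graph)
  have hB : ∀ z : H, (B z, z - B z) ∈ G.graph := by
    intro z
    have h1 : L (e.symm z) = z :=
      ContinuousLinearEquiv.ofBijective_apply_symm_apply L hinj hsurj z
    have h2 : z - B z = (e.symm z : H × H).2 := by
      rw [sub_eq_iff_eq_add, add_comm]
      exact h1.symm
    rw [h2]
    exact (e.symm z).2
  have hB' : ∀ x y : H, (x, y) ∈ G.graph → B (x + y) = x := by
    intro x y h
    have h1 : e.symm (L ⟨(x, y), h⟩) = ⟨(x, y), h⟩ :=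
      ContinuousLinearEquiv.ofBijective_symm_apply_apply L hinj hsurj _
    change (e.symm (L ⟨(x, y), h⟩) : H × H).1 = x
    rw [h1]
  have hBs : ∀ z w : H, ⟪B z, w⟫_ℂ = ⟪z, B w⟫_ℂ := by
    intro z w
    have := hsym _ _ _ _ (hB z) (hB w)
    rw [inner_sub_left, inner_sub_right, sub_left_inj] at this
    exact this.symm
  refine ⟨B, ⟨hBs, fun z => ?_⟩, ⟨fun z w => ?_, fun z => ?_⟩, ?_, fun x y => ⟨fun h => ?_, fun h => ?_⟩⟩
  · have h1 := hpos _ _ (hB z)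
    rw [inner_sub_right, Complex.sub_re] at h1
    have h2 : (⟪B z, B z⟫_ℂ).re = ‖B z‖ ^ 2 := inner_self_eq_norm_sq (𝕜 := ℂ) _
    change 0 ≤ (⟪B z, z⟫_ℂ).re
    nlinarith [sq_nonneg ‖B z‖]
  · change ⟪z - B z, w⟫_ℂ = ⟪z, w - B w⟫_ℂ
    rw [inner_sub_left, inner_sub_right, hBs]
  · change 0 ≤ (⟪z - B z, z⟫_ℂ).re
    have h1 := hpos _ _ (hB z)
    have h2 : (⟪z - B z, z - B z⟫_ℂ).re = ‖z - B z‖ ^ 2 := inner_self_eq_norm_sq (𝕜 := ℂ) _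
    have h3 : (⟪z - B z, B z⟫_ℂ).re = (⟪B z, z - B z⟫_ℂ).re := inner_re_symm (𝕜 := ℂ) _ _
    rw [inner_sub_right, Complex.sub_re] at h2
    nlinarith [sq_nonneg ‖z - B z‖]
  · intro z w h
    have h1 := hB z
    have h2 := hB w
    rw [h] at h1
    have := G.mem_graph_snd_inj h1 h2 rfl
    simpa using this
  · exact (hB' x y h).symm
  · have := hB (x + y)
    rw [← h, add_sub_cancel_left] at this
    exact this

/-- Every positive self-adjoint operator has a positive square root. -/
theorem IsPositiveSelfAdjoint.exists_isPositiveSqrt {G : H →ₗ.[ℂ] H}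
    (hG : IsPositiveSelfAdjoint G) : ∃ S : H →ₗ.[ℂ] H, IsPositiveSqrt S G := by
  obtain ⟨B, hB0, hB1, hBinj, hBG⟩ := hG.exists_resolvent
  have hB0' : 0 ≤ B := B.nonneg_iff_isPositive.2 hB0
  have hB1' : 0 ≤ 1 - B := (1 - B).nonneg_iff_isPositive.2 hB1
  let C := CFC.sqrt B
  let D := CFC.sqrt (1 - B)
  have hCC : ∀ x, C (C x) = B x := fun x =>
    congrArg (fun T : H →L[ℂ] H => T x) (CFC.sqrt_mul_sqrt_self B hB0')
  have hDD : ∀ x, D (D x) = x - B x := fun x =>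
    congrArg (fun T : H →L[ℂ] H => T x) (CFC.sqrt_mul_sqrt_self (1 - B) hB1')
  have hcomm : Commute C D :=
    ((((Commute.one_right B).sub_right (Commute.refl B)).cfcₙ_nnreal _).symm.cfcₙ_nnreal _).symm
  have hCD : ∀ x, C (D x) = D (C x) := fun x =>
    congrArg (fun T : H →L[ℂ] H => T x) hcomm.eq
  have hCp : C.IsPositive := C.nonneg_iff_isPositive.1 (CFC.sqrt_nonneg B)
  have hDp : D.IsPositive := D.nonneg_iff_isPositive.1 (CFC.sqrt_nonneg (1 - B))
  have hCDp : (C * D).IsPositive := (C * D).nonneg_iff_isPositive.1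
    (hcomm.mul_nonneg (CFC.sqrt_nonneg B) (CFC.sqrt_nonneg (1 - B)))
  have hCs : ∀ x y, ⟪C x, y⟫_ℂ = ⟪x, C y⟫_ℂ := hCp.inner_left_eq_inner_right
  have hDs : ∀ x y, ⟪D x, y⟫_ℂ = ⟪x, D y⟫_ℂ := hDp.inner_left_eq_inner_right
  have hCinj : Function.Injective C := by
    intro x y h
    apply hBinj
    rw [← hCC, ← hCC, h]
  have hsum : ∀ x, C (C x) + D (D x) = x := fun x => by rw [hCC, hDD]; abel
  let S : H →ₗ.[ℂ] H :=
    { domain := LinearMap.range (C : H →ₗ[ℂ] H)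
      toFun := (D : H →ₗ[ℂ] H) ∘ₗ
        ((LinearEquiv.ofInjective (C : H →ₗ[ℂ] H) hCinj).symm : _ →ₗ[ℂ] H) }
  have hS : ∀ x y : H, (x, y) ∈ S.graph ↔ ∃ u, C u = x ∧ D u = y := by
    intro x y
    rw [LinearPMap.mem_graph_iff]
    constructor
    · rintro ⟨u, rfl, rfl⟩
      refine ⟨(LinearEquiv.ofInjective (C : H →ₗ[ℂ] H) hCinj).symm u, ?_, rfl⟩
      exact congrArg Subtype.val
        ((LinearEquiv.ofInjective (C : H →ₗ[ℂ] H) hCinj).apply_symm_apply u)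
    · rintro ⟨u, rfl, rfl⟩
      refine ⟨LinearEquiv.ofInjective (C : H →ₗ[ℂ] H) hCinj u, rfl, ?_⟩
      change D ((LinearEquiv.ofInjective (C : H →ₗ[ℂ] H) hCinj).symm _) = _
      rw [LinearEquiv.symm_apply_apply]
  have hdense : Dense (S.domain : Set H) := by
    refine hG.dense.mono ?_
    intro x hx
    have := (hBG x (G ⟨x, hx⟩)).1 (G.mem_graph ⟨x, hx⟩)
    rw [this, ← hCC]
    exact ⟨_, rfl⟩
  refine ⟨S, ⟨hdense, ?_, ?_⟩, ?_⟩
  · rw [LinearPMap.isSelfAdjoint_def]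
    apply LinearPMap.eq_of_eq_graph
    rw [LinearPMap.adjoint_graph_eq_graph_adjoint hdense]
    ext ⟨y, w⟩
    rw [Submodule.mem_adjoint_iff, hS]
    constructor
    · intro h
      have hw : C w = D y := by
        refine ext_inner_left ℂ fun x => ?_
        have := h (C x) (D x) ((hS _ _).2 ⟨x, rfl, rfl⟩)
        rw [sub_eq_zero, hCs, hDs] at this
        exact this.symm
      refine ⟨C y + D w, ?_, ?_⟩
      · rw [map_add, hCD, hw, hsum]
      · rw [map_add, ← hCD, ← hw, hsum]
    · rintro ⟨u, rfl, rfl⟩ a b hab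
      obtain ⟨v, rfl, rfl⟩ := (hS _ _).1 hab
      rw [hDs, hCs, hCD, sub_self]
  · intro x
    obtain ⟨u, hu, hu'⟩ := (hS _ _).1 (S.mem_graph x)
    rw [← hu, ← hu']
    have h1 := hCDp.re_inner_nonneg_right u
    rw [hCs]
    exact h1
  · intro x y
    rw [hBG]
    constructor
    · intro h
      refine ⟨D (C (x + y)), (hS _ _).2 ⟨C (x + y), ?_, rfl⟩, (hS _ _).2 ⟨D (x + y), hCD _, ?_⟩⟩
      · rw [hCC, ← h]
      · rw [hDD, ← h]; abel
    · rintro ⟨z, h1, h2⟩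
      obtain ⟨u, rfl, rfl⟩ := (hS _ _).1 h1
      obtain ⟨v, hv, rfl⟩ := (hS _ _).1 h2
      have hu : C (C u + D v) = u := by
        rw [map_add, hCD, hv, hsum]
      rw [← hCC, hu]

/-- `sqrtOp G` is a positive square root of `G`. -/
theorem IsPositiveSelfAdjoint.isPositiveSqrt_sqrtOp {G : H →ₗ.[ℂ] H}
    (hG : IsPositiveSelfAdjoint G) : IsPositiveSqrt (sqrtOp G) G :=
  Classical.epsilon_spec hG.exists_isPositiveSqrt

open Classical in
/-- The quantity `⟨φ|G|φ⟩`: it is `‖√G φ‖²` if `φ` is in the domain of `√G`, and `+∞` otherwise. -/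
def energy (G : H →ₗ.[ℂ] H) (φ : H) : ENNReal :=
  if h : φ ∈ (sqrtOp G).domain then ENNReal.ofReal (‖sqrtOp G ⟨φ, h⟩‖ ^ 2) else ⊤

/-- The set of unit vectors `φ` with `⟨φ|G|φ⟩ ≤ E`. -/
def energyBall (G : H →ₗ.[ℂ] H) (E : ℝ) : Set H :=
  {φ | ‖φ‖ = 1 ∧ energy G φ ≤ ENNReal.ofReal E}

theorem bddAbove_range (G : H →ₗ.[ℂ] H) (E : ℝ) (A : H →L[ℂ] H) :
    BddAbove (Set.range fun φ : energyBall G E => ‖A φ‖) := by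
  refine ⟨‖A‖, ?_⟩
  rintro _ ⟨φ, rfl⟩
  simpa [φ.2.1] using A.le_opNorm φ

/-- The operator `E`-norm `‖A‖^G_E`, the supremum of `‖A φ‖` over the unit vectors `φ` with
`⟨φ|G|φ⟩ ≤ E`, with the proof that it is a seminorm on the bounded operators. -/
def eNorm (G : H →ₗ.[ℂ] H) (E : ℝ) : Seminorm ℂ (H →L[ℂ] H) :=
  Seminorm.of (fun A => ⨆ φ : energyBall G E, ‖A φ‖)
    (fun A B => by
      refine Real.iSup_le (fun φ => ?_) (add_nonneg (Real.iSup_nonneg fun _ => norm_nonneg _)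
        (Real.iSup_nonneg fun _ => norm_nonneg _))
      exact (norm_add_le _ _).trans
        (add_le_add (le_ciSup (bddAbove_range G E A) φ) (le_ciSup (bddAbove_range G E B) φ)))
    (fun c A => by
      simp only [smul_apply, norm_smul]
      exact (Real.mul_iSup_of_nonneg (norm_nonneg c) _).symm)

/-- The topology on the space of bounded operators generated by a (semi)norm `p`, that is, the
topology of the distance `p (A - B)`. -/
abbrev normTopology (p : Seminorm ℂ (H →L[ℂ] H)) : TopologicalSpace (H →L[ℂ] H) :=
  p.toAddGroupSeminorm.toSeminormedAddCommGroup.toPseudoMetricSpace.toUniformSpace.toTopologicalSpace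

/-- The strong operator topology on the space of bounded operators. -/
abbrev strongOperatorTopology : TopologicalSpace (H →L[ℂ] H) :=
  TopologicalSpace.induced
    (ContinuousLinearMap.toPointwiseConvergenceCLM ℂ (RingHom.id ℂ) H H) inferInstance

/-- The norm `p` generates the strong operator topology on bounded subsets: on every subset `𝓑`
bounded in the operator norm, the two topologies induce the same subspace topology. -/
def GeneratesSOTOnBounded (p : Seminorm ℂ (H →L[ℂ] H)) : Prop :=
  ∀ 𝓑 : Set (H →L[ℂ] H), Bornology.IsBounded 𝓑 →
    TopologicalSpace.induced (Subtype.val : 𝓑 → (H →L[ℂ] H)) (normTopology p) =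
      TopologicalSpace.induced (Subtype.val : 𝓑 → (H →L[ℂ] H)) strongOperatorTopology

/-- The (semi)norm `p` is equivalent to the operator norm. -/
def EquivOpNorm (p : Seminorm ℂ (H →L[ℂ] H)) : Prop :=
  ∃ c C : ℝ, 0 < c ∧ 0 < C ∧ ∀ A : H →L[ℂ] H, c * ‖A‖ ≤ p A ∧ p A ≤ C * ‖A‖

/-- The operator `G` is bounded on its domain. -/
def IsBoundedOp (G : H →ₗ.[ℂ] H) : Prop :=
  ∃ C : ℝ, ∀ x : G.domain, ‖G x‖ ≤ C * ‖(x : H)‖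

/-- `G` is discrete: `G = ∑ₖ Eₖ |τₖ⟩⟨τₖ|` on the domain `{φ | ∑ₖ Eₖ² |⟨τₖ|φ⟩|² < ∞}` for an
orthonormal basis `τ₀, τ₁, …` and a nondecreasing sequence `E₀ ≤ E₁ ≤ …` tending to `+∞`. -/
def IsDiscreteOp (G : H →ₗ.[ℂ] H) : Prop :=
  ∃ (τ : HilbertBasis ℕ ℂ H) (e : ℕ → ℝ), Monotone e ∧
    Filter.Tendsto e Filter.atTop Filter.atTop ∧
    (∀ φ : H, φ ∈ G.domain ↔ Summable fun k => e k ^ 2 * ‖⟪τ k, φ⟫_ℂ‖ ^ 2) ∧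
    ∀ φ : G.domain, HasSum (fun k => ((e k : ℂ) * ⟪τ k, (φ : H)⟫_ℂ) • τ k) (G φ)

end OperatorENorm

end

/-!
Write `S = √G`. The energy norm `‖A‖^G_E` only tests `A` on unit vectors with `‖S φ‖² ≤ E`, but it
controls `A` on the whole domain of `S`: `‖A x‖ ≤ C (‖x‖ + ‖S x‖) ‖A‖^G_E`
(`exists_norm_apply_le_graph_norm_mul_eNorm`). Indeed there is a unit vector `φ₀` of energy well
below `E`, and for small `x` both `φ₀` and `φ₀ + x` have energy at most `E` after normalisation.

*Equivalence with the operator norm.* If `G` is bounded then so is `S`, and the estimate above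
bounds `‖A‖` by a multiple of `‖A‖^G_E`. Conversely, the operator `|S χ⟩⟨S χ|` has norm `‖S χ‖²` and
energy norm at most `√E ‖χ‖ ‖S χ‖`, so an equivalence of the norms bounds `‖S χ‖` by a multiple
of `‖χ‖`.

*Strong operator topology.* On bounded sets, convergence in the energy norm always implies strong
convergence, by the estimate above and the density of the domain of `S`. If `G` is discrete, a
vector of bounded energy is uniformly close to its projection onto finitely many `τ k`
(`norm_apply_le_sum_add`), so strong convergence implies convergence in the energy norm. Conversely,
the projections onto finite-dimensional subspaces tend strongly to `1`. If they do so in the energy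
norm as well, then by the estimate above the resolvent `(1 + G)⁻¹` is a norm limit of operators of
finite rank, hence compact (`isCompactOperator_resolvent`). Its eigenvectors, sorted by eigenvalue,
make `G` discrete, and a discrete operator on an infinite-dimensional space is unbounded.
-/

namespace OperatorENorm

variable {H : Type*} [NormedAddCommGroup H] [InnerProductSpace ℂ H] [CompleteSpace H]

/-! ### The square root of a positive self-adjoint operator -/

theorem IsPositiveSelfAdjoint.inner_graph_symm {T : H →ₗ.[ℂ] H} (hT : IsPositiveSelfAdjoint T)
    {x y x' y' : H} (h : (x, y) ∈ T.graph) (h' : (x', y') ∈ T.graph) :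
    ⟪y, x'⟫_ℂ = ⟪x, y'⟫_ℂ := by
  have hadj : T.adjoint = T := hT.selfAdjoint
  rw [← hadj, LinearPMap.adjoint_graph_eq_graph_adjoint hT.dense, Submodule.mem_adjoint_iff] at h'
  exact sub_eq_zero.1 (h' x y h)

theorem IsPositiveSelfAdjoint.exists_sqrtOp_graph {G : H →ₗ.[ℂ] H} (hG : IsPositiveSelfAdjoint G)
    {x y : H} (h : (x, y) ∈ G.graph) :
    ∃ z, (x, z) ∈ (sqrtOp G).graph ∧ (z, y) ∈ (sqrtOp G).graph ∧ ‖z‖ ^ 2 = (⟪x, y⟫_ℂ).re := by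
  obtain ⟨z, hxz, hzy⟩ := (hG.isPositiveSqrt_sqrtOp.sq x y).1 h
  refine ⟨z, hxz, hzy, ?_⟩
  rw [← hG.isPositiveSqrt_sqrtOp.pos.inner_graph_symm hxz hzy]
  exact (inner_self_eq_norm_sq (𝕜 := ℂ) z).symm

theorem IsPositiveSelfAdjoint.dense_sqrtOp_domain {G : H →ₗ.[ℂ] H}
    (hG : IsPositiveSelfAdjoint G) : Dense {x : H | ∃ z, (x, z) ∈ (sqrtOp G).graph} := by
  refine hG.isPositiveSqrt_sqrtOp.pos.dense.mono fun x hx => ?_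
  exact ⟨_, (sqrtOp G).mem_graph ⟨x, hx⟩⟩

/-! ### The energy norm and its equivalence with the operator norm -/

section eNorm

variable {G : H →ₗ.[ℂ] H} {E : ℝ}

theorem mem_energyBall_iff (hE : 0 ≤ E) (x : H) :
    x ∈ energyBall G E ↔ ‖x‖ = 1 ∧ ∃ z, (x, z) ∈ (sqrtOp G).graph ∧ ‖z‖ ≤ √E := by
  refine and_congr_right fun _ => ?_
  unfold energy
  constructor
  · intro h
    split_ifs at h with hx
    · refine ⟨_, (sqrtOp G).mem_graph ⟨x, hx⟩, Real.le_sqrt_of_sq_le ?_⟩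
      exact (ENNReal.ofReal_le_ofReal_iff hE).1 h
    · exact absurd h (by simp)
  · rintro ⟨z, hz, hzE⟩
    obtain ⟨u, rfl, rfl⟩ := (LinearPMap.mem_graph_iff _).1 hz
    rw [dif_pos u.2]
    exact ENNReal.ofReal_le_ofReal ((Real.le_sqrt (norm_nonneg _) hE).1 hzE)

theorem eNorm_le_of_forall (hE : 0 ≤ E) {A : H →L[ℂ] H} {M : ℝ} (hM : 0 ≤ M)
    (h : ∀ x z, (x, z) ∈ (sqrtOp G).graph → ‖x‖ = 1 → ‖z‖ ≤ √E → ‖A x‖ ≤ M) :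
    eNorm G E A ≤ M := by
  refine Real.iSup_le (fun φ => ?_) hM
  obtain ⟨h1, z, hz, hzE⟩ := (mem_energyBall_iff hE φ.1).1 φ.2
  exact h _ _ hz h1 hzE

theorem eNorm_le_opNorm (hE : 0 ≤ E) (A : H →L[ℂ] H) : eNorm G E A ≤ ‖A‖ :=
  eNorm_le_of_forall hE (norm_nonneg _) fun x _ _ hx _ => by simpa [hx] using A.le_opNorm x

theorem norm_apply_le_mul_eNorm (hE : 0 ≤ E) (A : H →L[ℂ] H) {x z : H}
    (hxz : (x, z) ∈ (sqrtOp G).graph) (hz : ‖z‖ ≤ √E * ‖x‖) :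
    ‖A x‖ ≤ ‖x‖ * eNorm G E A := by
  rcases eq_or_ne x 0 with rfl | hx
  · simp
  have hx' : 0 < ‖x‖ := norm_pos_iff.2 hx
  have hc : ‖((‖x‖⁻¹ : ℝ) : ℂ)‖ = ‖x‖⁻¹ := by simp
  have hmem : ((‖x‖⁻¹ : ℝ) : ℂ) • x ∈ energyBall G E := by
    refine (mem_energyBall_iff hE _).2 ⟨?_, ((‖x‖⁻¹ : ℝ) : ℂ) • z,
      (sqrtOp G).graph.smul_mem _ hxz, ?_⟩
    · rw [norm_smul, hc, inv_mul_cancel₀ hx'.ne']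
    · rw [norm_smul, hc, inv_mul_le_iff₀ hx', mul_comm]
      exact hz
  have h1 : ‖A (((‖x‖⁻¹ : ℝ) : ℂ) • x)‖ ≤ eNorm G E A :=
    le_ciSup (bddAbove_range G E A) ⟨_, hmem⟩
  rwa [map_smul, norm_smul, hc, inv_mul_le_iff₀ hx'] at h1

/-- The energy norm controls the operator on the form domain of `G`, with the graph norm of `√G`.
A vector of small graph norm, added to a unit vector of energy well below `E`, still has energy at
most `E` times its squared norm; this is where the vanishing of `inf ‖G φ‖` enters. -/
theorem exists_norm_apply_le_graph_norm_mul_eNorm (hG : IsPositiveSelfAdjoint G)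
    (hinf : IsGLB {r : ℝ | ∃ φ : G.domain, ‖(φ : H)‖ = 1 ∧ r = ‖G φ‖} 0) (hE : 0 < E) :
    ∃ C : ℝ, 0 < C ∧ ∀ (A : H →L[ℂ] H) (x z : H), (x, z) ∈ (sqrtOp G).graph →
      ‖A x‖ ≤ C * (‖x‖ + ‖z‖) * eNorm G E A := by
  obtain ⟨φ₀, z₀, hφ₀, hφz, hz₀⟩ :
      ∃ φ₀ z₀ : H, ‖φ₀‖ = 1 ∧ (φ₀, z₀) ∈ (sqrtOp G).graph ∧ ‖z₀‖ ≤ √E / 4 := by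
    obtain ⟨r, ⟨φ, hφ, rfl⟩, -, hr⟩ := hinf.exists_between (show (0 : ℝ) < E / 16 by positivity)
    obtain ⟨z, hz, -, hz2⟩ := hG.exists_sqrtOp_graph (G.mem_graph φ)
    refine ⟨φ, z, hφ, hz, ?_⟩
    have h1 : (⟪(φ : H), G φ⟫_ℂ).re ≤ ‖(φ : H)‖ * ‖G φ‖ := re_inner_le_norm (𝕜 := ℂ) _ _
    rw [hφ, one_mul, ← hz2] at h1
    refine abs_le_of_sq_le_sq' ?_ (by positivity) |>.2
    rw [div_pow, Real.sq_sqrt hE.le]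
    linarith
  have hsE : 0 < √E := Real.sqrt_pos.2 hE
  -- the smallness of the graph norm that makes the perturbation argument work
  set δ : ℝ := min (1 / 2) (√E / 4) with hδ
  have hδ0 : 0 < δ := by positivity
  have key : ∀ (A : H →L[ℂ] H) (x z : H), (x, z) ∈ (sqrtOp G).graph → ‖x‖ + ‖z‖ ≤ δ →
      ‖A x‖ ≤ 5 / 2 * eNorm G E A := by
    intro A x z hxz h
    have hx : ‖x‖ ≤ 1 / 2 := by linarith [norm_nonneg z, min_le_left (1 / 2) (√E / 4)]
    have hz : ‖z‖ ≤ √E / 4 := by linarith [norm_nonneg x, min_le_right (1 / 2) (√E / 4)]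
    have hlow : 1 / 2 ≤ ‖φ₀ + x‖ := by
      have := norm_sub_le (φ₀ + x) x
      rw [add_sub_cancel_right] at this
      linarith
    have hup : ‖φ₀ + x‖ ≤ 3 / 2 := by linarith [norm_add_le φ₀ x]
    have hp : 0 ≤ eNorm G E A := apply_nonneg _ _
    have h1 : ‖A (φ₀ + x)‖ ≤ ‖φ₀ + x‖ * eNorm G E A := by
      refine norm_apply_le_mul_eNorm hE.le A ((sqrtOp G).graph.add_mem hφz hxz) ?_
      nlinarith [norm_add_le z₀ z]
    have h2 : ‖A φ₀‖ ≤ ‖φ₀‖ * eNorm G E A := by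
      refine norm_apply_le_mul_eNorm hE.le A hφz ?_
      rw [hφ₀]
      linarith
    have h3 : ‖A x‖ ≤ ‖A (φ₀ + x)‖ + ‖A φ₀‖ := by
      have := norm_sub_le (A (φ₀ + x)) (A φ₀)
      rwa [map_add, add_sub_cancel_left, ← map_add] at this
    rw [hφ₀] at h2
    nlinarith
  refine ⟨5 / 2 / δ, by positivity, fun A x z hxz => ?_⟩
  rcases eq_or_ne x 0 with rfl | hx
  · rw [map_zero, norm_zero]
    have : 0 ≤ eNorm G E A := apply_nonneg _ _
    positivity
  have hs : 0 < ‖x‖ + ‖z‖ := add_pos_of_pos_of_nonneg (norm_pos_iff.2 hx) (norm_nonneg _)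
  set t : ℝ := δ / (‖x‖ + ‖z‖) with ht
  have ht0 : 0 < t := by positivity
  have hc : ‖(t : ℂ)‖ = t := by simp [abs_of_pos ht0]
  have h1 := key A ((t : ℂ) • x) ((t : ℂ) • z) ((sqrtOp G).graph.smul_mem _ hxz) (by
    rw [norm_smul, norm_smul, hc, ← mul_add, ht, div_mul_cancel₀ _ hs.ne'])
  rw [map_smul, norm_smul, hc, ht, div_mul_eq_mul_div, div_le_iff₀ hs] at h1
  rw [div_mul_eq_mul_div, div_mul_eq_mul_div, le_div_iff₀ hδ0]
  linarith

theorem IsPositiveSelfAdjoint.isBoundedOp_of_sqrtOp {G : H →ₗ.[ℂ] H} (hG : IsPositiveSelfAdjoint G)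
    {C : ℝ} (h : ∀ x z, (x, z) ∈ (sqrtOp G).graph → ‖z‖ ≤ C * ‖x‖) : IsBoundedOp G := by
  refine ⟨C * C, fun x => ?_⟩
  obtain ⟨z, hxz, hzy, -⟩ := hG.exists_sqrtOp_graph (G.mem_graph x)
  have h1 := h _ _ hxz
  have h2 := h _ _ hzy
  rcases le_or_gt 0 C with hC | hC
  · nlinarith
  · have h3 : ‖z‖ = 0 := by nlinarith [norm_nonneg z, norm_nonneg (x : H)]
    rw [h3, mul_zero] at h2
    exact h2.trans (mul_nonneg (mul_self_nonneg C) (norm_nonneg _))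

theorem equivOpNorm_of_isBoundedOp (hG : IsPositiveSelfAdjoint G)
    (hinf : IsGLB {r : ℝ | ∃ φ : G.domain, ‖(φ : H)‖ = 1 ∧ r = ‖G φ‖} 0) (hE : 0 < E)
    (hb : IsBoundedOp G) : EquivOpNorm (eNorm G E) := by
  obtain ⟨M, hM⟩ := hb
  obtain ⟨C, hC, h⟩ := exists_norm_apply_le_graph_norm_mul_eNorm hG hinf hE
  have hp : ∀ A, 0 ≤ eNorm G E A := fun A => apply_nonneg _ _
  set K : ℝ := C * (1 + √|M|) with hK
  have hK0 : 0 < K := by positivity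
  have hle : ∀ A : H →L[ℂ] H, ‖A‖ ≤ K * eNorm G E A := by
    intro A
    refine A.opNorm_le_bound (mul_nonneg hK0.le (hp A)) fun x => ?_
    have hcl : IsClosed {x : H | ‖A x‖ ≤ K * eNorm G E A * ‖x‖} :=
      isClosed_le (by fun_prop) (by fun_prop)
    refine hcl.closure_subset_iff.2 ?_ (hG.dense x)
    intro x hx
    obtain ⟨z, hxz, -, hz⟩ := hG.exists_sqrtOp_graph (G.mem_graph ⟨x, hx⟩)
    have h1 : ‖z‖ ≤ √|M| * ‖x‖ := by
      refine abs_le_of_sq_le_sq' ?_ (by positivity) |>.2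
      rw [hz, mul_pow, Real.sq_sqrt (abs_nonneg M)]
      have h2 : (⟪x, G ⟨x, hx⟩⟫_ℂ).re ≤ ‖x‖ * ‖G ⟨x, hx⟩‖ := re_inner_le_norm (𝕜 := ℂ) _ _
      have h3 : ‖G ⟨x, hx⟩‖ ≤ |M| * ‖x‖ :=
        (hM ⟨x, hx⟩).trans (mul_le_mul_of_nonneg_right (le_abs_self M) (norm_nonneg _))
      nlinarith [norm_nonneg x]
    calc ‖A x‖ ≤ C * (‖x‖ + ‖z‖) * eNorm G E A := h A x z hxz
      _ ≤ C * (‖x‖ + √|M| * ‖x‖) * eNorm G E A := by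
        gcongr
      _ = K * eNorm G E A * ‖x‖ := by rw [hK]; ring
  refine ⟨K⁻¹, 1, by positivity, one_pos, fun A => ⟨?_, ?_⟩⟩
  · rw [inv_mul_le_iff₀ hK0]
    exact hle A
  · rw [one_mul]
    exact eNorm_le_opNorm hE.le A

/-- Testing the equivalence on the rank one operators `|√G χ⟩⟨√G χ|` shows that `√G` is bounded:
on vectors of energy at most `E` such an operator is at most `√E ‖χ‖ ‖√G χ‖`. -/
theorem isBoundedOp_of_equivOpNorm (hG : IsPositiveSelfAdjoint G) (hE : 0 < E)
    (h : EquivOpNorm (eNorm G E)) : IsBoundedOp G := by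
  obtain ⟨c, C, hc, -, h⟩ := h
  refine hG.isBoundedOp_of_sqrtOp (C := √E / c) fun χ ψ hχ => ?_
  rcases eq_or_ne ψ 0 with rfl | hψ
  · rw [norm_zero]
    positivity
  have hψ' : 0 < ‖ψ‖ := norm_pos_iff.2 hψ
  set A : H →L[ℂ] H := InnerProductSpace.rankOne ℂ ψ ψ with hA
  have h1 : eNorm G E A ≤ √E * ‖χ‖ * ‖ψ‖ := by
    refine eNorm_le_of_forall hE.le (by positivity) fun x z hxz _ hz => ?_
    rw [hA, InnerProductSpace.rankOne_apply, norm_smul,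
      hG.isPositiveSqrt_sqrtOp.pos.inner_graph_symm hχ hxz]
    gcongr
    calc ‖⟪χ, z⟫_ℂ‖ ≤ ‖χ‖ * ‖z‖ := norm_inner_le_norm _ _
      _ ≤ √E * ‖χ‖ := by
        rw [mul_comm]
        gcongr
  have h2 : c * ‖A‖ ≤ eNorm G E A := (h A).1
  rw [hA, InnerProductSpace.norm_rankOne, ← hA] at h2
  rw [div_mul_eq_mul_div, le_div_iff₀ hc]
  have h3 : c * ‖ψ‖ * ‖ψ‖ ≤ √E * ‖χ‖ * ‖ψ‖ := by linarith
  linarith [le_of_mul_le_mul_right h3 hψ']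

end eNorm

/-! ### Convergence criterion for the strong operator topology on bounded sets -/

section topology

open Filter Topology

omit [CompleteSpace H]

theorem le_nhds_normTopology_iff (p : Seminorm ℂ (H →L[ℂ] H)) (l : Filter (H →L[ℂ] H))
    (A : H →L[ℂ] H) :
    l ≤ @nhds _ (normTopology p) A ↔ Tendsto (fun X => p (X - A)) l (𝓝 0) := by
  let _ : SeminormedAddCommGroup (H →L[ℂ] H) :=
    p.toAddGroupSeminorm.toSeminormedAddCommGroup
  exact tendsto_iff_norm_sub_tendsto_zero (f := fun X : H →L[ℂ] H => X)

theorem le_nhds_strongOperatorTopology_iff (l : Filter (H →L[ℂ] H)) (A : H →L[ℂ] H) :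
    l ≤ @nhds _ strongOperatorTopology A ↔ ∀ x, Tendsto (fun X => X x) l (𝓝 (A x)) := by
  rw [nhds_induced, ← tendsto_iff_comap, PointwiseConvergenceCLM.tendsto_iff_forall_tendsto]
  rfl

theorem induced_subtype_val_eq_iff {α : Type*} (t₁ t₂ : TopologicalSpace α) (s : Set α) :
    TopologicalSpace.induced (Subtype.val : s → α) t₁ =
        TopologicalSpace.induced (Subtype.val : s → α) t₂ ↔
      ∀ a ∈ s, ∀ l : Filter α, s ∈ l → (l ≤ @nhds α t₁ a ↔ l ≤ @nhds α t₂ a) := by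
  simp_rw [TopologicalSpace.ext_iff_nhds, nhds_induced, Subtype.forall]
  refine forall₂_congr fun a _ => ?_
  rw [← (map_injective (Subtype.val_injective (p := (· ∈ s)))).eq_iff, map_comap, map_comap,
    Subtype.range_val]
  constructor
  · intro h l hl
    have hl' : l ≤ 𝓟 s := le_principal_iff.2 hl
    rw [← and_iff_left (a := l ≤ @nhds _ t₁ a) hl', ← le_inf_iff, h, le_inf_iff,
      and_iff_left hl']
  · intro h
    refine le_antisymm (le_inf ?_ inf_le_right) (le_inf ?_ inf_le_right)
    · exact (h _ (mem_inf_of_right (mem_principal_self _))).1 inf_le_left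
    · exact (h _ (mem_inf_of_right (mem_principal_self _))).2 inf_le_left

/-- Convergence along filters carried by a bounded set, with a limit in this set, characterises
the two subspace topologies. -/
theorem generatesSOTOnBounded_iff (p : Seminorm ℂ (H →L[ℂ] H)) :
    GeneratesSOTOnBounded p ↔ ∀ 𝓑 : Set (H →L[ℂ] H), Bornology.IsBounded 𝓑 → ∀ A ∈ 𝓑,
      ∀ l : Filter (H →L[ℂ] H), 𝓑 ∈ l →
        (Tendsto (fun X => p (X - A)) l (𝓝 0) ↔ ∀ x, Tendsto (fun X => X x) l (𝓝 (A x))) := by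
  refine forall₂_congr fun 𝓑 _ => (induced_subtype_val_eq_iff _ _ _).trans ?_
  simp only [← le_nhds_normTopology_iff, ← le_nhds_strongOperatorTopology_iff]

end topology

/-! ### Strong convergence and the energy norm -/

section discrete

open Filter Topology

variable {G : H →ₗ.[ℂ] H} {E : ℝ}

omit [CompleteSpace H] in
theorem hasSum_norm_inner_sq (b : HilbertBasis ℕ ℂ H) (x : H) :
    HasSum (fun k => ‖⟪b k, x⟫_ℂ‖ ^ 2) (‖x‖ ^ 2) := by
  have h := Complex.hasSum_re (b.hasSum_inner_mul_inner x x)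
  have h1 : (⟪x, x⟫_ℂ).re = ‖x‖ ^ 2 := inner_self_eq_norm_sq (𝕜 := ℂ) x
  rw [h1] at h
  refine h.congr_fun fun k => ?_
  rw [← inner_conj_symm x (b k), Complex.conj_mul', ← Complex.ofReal_pow, Complex.ofReal_re]

omit [CompleteSpace H] in
theorem mem_graph_basis {τ : HilbertBasis ℕ ℂ H} {e : ℕ → ℝ}
    (hdom : ∀ φ : H, φ ∈ G.domain ↔ Summable fun k => e k ^ 2 * ‖⟪τ k, φ⟫_ℂ‖ ^ 2)
    (hG : ∀ φ : G.domain, HasSum (fun k => ((e k : ℂ) * ⟪τ k, (φ : H)⟫_ℂ) • τ k) (G φ)) (n : ℕ) :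
    (τ n, (e n : ℂ) • τ n) ∈ G.graph := by
  have hoff : ∀ k, k ≠ n → ⟪τ k, τ n⟫_ℂ = 0 := fun k hk => τ.orthonormal.2 hk
  have hn : τ n ∈ G.domain := (hdom _).2 <| summable_of_ne_finset_zero (s := {n}) fun k hk => by
    rw [hoff k (by simpa using hk)]
    simp
  have h1 := (hG ⟨τ n, hn⟩).unique (hasSum_single n fun k hk => by rw [hoff k hk]; simp)
  rw [inner_self_eq_norm_sq_to_K, τ.orthonormal.1 n] at h1
  simp only [Complex.coe_algebraMap, Complex.ofReal_one, one_pow, mul_one] at h1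
  rw [← h1]
  exact G.mem_graph ⟨τ n, hn⟩

/-- One half of the quadratic form identity `‖√G x‖² = ∑ₖ eₖ |⟨vₖ|x⟩|²`, by the Cauchy-Schwarz
inequality for `√G u` and `√G x`, where `u` is the truncated expansion of `x`. -/
theorem IsPositiveSelfAdjoint.sum_mul_norm_inner_sq_le (hG : IsPositiveSelfAdjoint G)
    {v : ℕ → H} (hv : Orthonormal ℂ v) {e : ℕ → ℝ}
    (hgr : ∀ k, (v k, (e k : ℂ) • v k) ∈ G.graph) {x z : H} (hxz : (x, z) ∈ (sqrtOp G).graph)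
    (s : Finset ℕ) : ∑ k ∈ s, e k * ‖⟪v k, x⟫_ℂ‖ ^ 2 ≤ ‖z‖ ^ 2 := by
  set Q : ℝ := ∑ k ∈ s, e k * ‖⟪v k, x⟫_ℂ‖ ^ 2 with hQ
  have hmem : (∑ k ∈ s, ⟪v k, x⟫_ℂ • v k, ∑ k ∈ s, ⟪v k, x⟫_ℂ • (e k : ℂ) • v k) ∈ G.graph := by
    have : ∑ k ∈ s, ⟪v k, x⟫_ℂ • (v k, (e k : ℂ) • v k) ∈ G.graph :=
      Submodule.sum_mem _ fun k _ => G.graph.smul_mem _ (hgr k)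
    convert this using 1
    ext <;> simp [Prod.fst_sum, Prod.snd_sum]
  obtain ⟨w, huw, hwy, hw⟩ := hG.exists_sqrtOp_graph hmem
  have hterm : ∀ k, (starRingEnd ℂ) ⟪v k, x⟫_ℂ * ((e k : ℂ) * ⟪v k, x⟫_ℂ) =
      ((e k * ‖⟪v k, x⟫_ℂ‖ ^ 2 : ℝ) : ℂ) := fun k => by
    rw [mul_left_comm, Complex.conj_mul']
    push_cast
    rfl
  have h1 : ‖w‖ ^ 2 = Q := by
    rw [hw]
    simp_rw [smul_smul]
    rw [hv.inner_sum, hQ, ← Complex.ofReal_re (∑ k ∈ s, _), Complex.ofReal_sum]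
    congr 1
    refine Finset.sum_congr rfl fun k _ => ?_
    rw [mul_comm ⟪v k, x⟫_ℂ, hterm]
  have h2 : ⟪w, z⟫_ℂ = (Q : ℂ) := by
    rw [← hG.isPositiveSqrt_sqrtOp.pos.inner_graph_symm hwy hxz, sum_inner, hQ, Complex.ofReal_sum]
    refine Finset.sum_congr rfl fun k _ => ?_
    rw [← hterm, smul_smul, inner_smul_left, map_mul, Complex.conj_ofReal, mul_assoc]
  have h3 : ‖⟪w, z⟫_ℂ‖ ≤ ‖w‖ * ‖z‖ := norm_inner_le_norm _ _
  rw [h2, Complex.norm_real, Real.norm_eq_abs, ← h1, abs_of_nonneg (by positivity)] at h3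
  rw [← h1]
  have : ‖w‖ ≤ ‖z‖ := by
    by_contra! hlt
    nlinarith [norm_nonneg z]
  gcongr

/-- On vectors of bounded energy an operator is controlled by its values at finitely many basis
vectors, up to a small tail. -/
theorem IsPositiveSelfAdjoint.norm_apply_le_sum_add (hG : IsPositiveSelfAdjoint G)
    (τ : HilbertBasis ℕ ℂ H) {e : ℕ → ℝ} (he : Monotone e)
    (hgr : ∀ k, (τ k, (e k : ℂ) • τ k) ∈ G.graph) {n : ℕ} (hn : 0 < e n) (A : H →L[ℂ] H)
    {x z : H} (hxz : (x, z) ∈ (sqrtOp G).graph) :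
    ‖A x‖ ≤ ‖x‖ * ∑ k ∈ Finset.range n, ‖A (τ k)‖ + ‖A‖ * (‖z‖ / √(e n)) := by
  set y : H := ∑ k ∈ Finset.range n, ⟪τ k, x⟫_ℂ • τ k with hy
  have hyin : ∀ k, ⟪τ k, x - y⟫_ℂ = if k < n then 0 else ⟪τ k, x⟫_ℂ := by
    intro k
    rw [inner_sub_right]
    split_ifs with hk
    · rw [hy, τ.orthonormal.inner_right_sum _ (Finset.mem_range.2 hk), sub_self]
    · rw [hy, inner_sum, Finset.sum_eq_zero, sub_zero]
      intro j hj
      rw [inner_smul_right, τ.orthonormal.2 (by rintro rfl; exact hk (Finset.mem_range.1 hj)), mul_zero]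
  -- Bessel's bound on the coefficients, where `e k ≥ e n` for the remaining indices `k ≥ n`
  have htail : ‖x - y‖ ≤ ‖z‖ / √(e n) := by
    refine abs_le_of_sq_le_sq' ?_ (by positivity) |>.2
    rw [div_pow, Real.sq_sqrt hn.le, le_div_iff₀ hn]
    refine hasSum_le_of_sum_le ((hasSum_norm_inner_sq τ (x - y)).mul_right (e n)) fun s => ?_
    refine le_trans ?_ (hG.sum_mul_norm_inner_sq_le τ.orthonormal hgr hxz (s.filter (n ≤ ·)))
    rw [Finset.sum_filter]
    refine Finset.sum_le_sum fun k _ => ?_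
    rw [hyin]
    split_ifs with h1 h2 h2
    · omega
    · simp
    · rw [mul_comm]
      gcongr
      exact he h2
    · omega
  have hhead : ‖A y‖ ≤ ‖x‖ * ∑ k ∈ Finset.range n, ‖A (τ k)‖ := by
    rw [hy, map_sum, Finset.mul_sum]
    refine norm_sum_le_of_le _ fun k _ => ?_
    rw [map_smul, norm_smul]
    gcongr
    have := norm_inner_le_norm (𝕜 := ℂ) (τ k) x
    rwa [τ.orthonormal.1 k, one_mul] at this
  calc ‖A x‖ = ‖A y + A (x - y)‖ := by rw [map_sub, add_sub_cancel]
    _ ≤ ‖A y‖ + ‖A (x - y)‖ := norm_add_le _ _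
    _ ≤ _ := add_le_add hhead ((A.le_opNorm _).trans (by gcongr))

theorem generatesSOTOnBounded_of_isDiscreteOp (hG : IsPositiveSelfAdjoint G)
    (hinf : IsGLB {r : ℝ | ∃ φ : G.domain, ‖(φ : H)‖ = 1 ∧ r = ‖G φ‖} 0) (hE : 0 < E)
    (hd : IsDiscreteOp G) : GeneratesSOTOnBounded (eNorm G E) := by
  rw [generatesSOTOnBounded_iff]
  intro 𝓑 h𝓑 A hA l hl
  obtain ⟨M, hM0, hM⟩ := h𝓑.exists_pos_norm_le
  have hXA : ∀ᶠ X in l, ‖X - A‖ ≤ 2 * M := by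
    filter_upwards [hl] with X hX
    linarith [norm_sub_le X A, hM X hX, hM A hA]
  constructor
  · intro hp x
    obtain ⟨C, hC, hCle⟩ := exists_norm_apply_le_graph_norm_mul_eNorm hG hinf hE
    rw [Metric.tendsto_nhds]
    intro ε hε
    obtain ⟨y, ⟨z, hyz⟩, hy⟩ := hG.dense_sqrtOp_domain.exists_dist_lt x
      (show 0 < ε / (4 * M) by positivity)
    have h1 := hp.const_mul (C * (‖y‖ + ‖z‖))
    rw [mul_zero] at h1
    filter_upwards [hXA, h1.eventually_lt_const (half_pos hε)] with X hX hX'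
    have h2 : ‖(X - A) (x - y)‖ ≤ 2 * M * ‖x - y‖ := (X - A).le_of_opNorm_le hX _
    rw [dist_eq_norm, lt_div_iff₀ (by positivity)] at hy
    have h3 := hCle (X - A) y z hyz
    have h4 : X x - A x = (X - A) (x - y) + (X - A) y := by
      rw [← map_add, sub_add_cancel]
      rfl
    rw [dist_eq_norm, h4]
    linarith [norm_add_le ((X - A) (x - y)) ((X - A) y)]
  · obtain ⟨τ, e, he, hetop, hdom, hGs⟩ := hd
    intro hs
    have hgr := mem_graph_basis hdom hGs
    rw [Metric.tendsto_nhds]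
    intro ε hε
    have hlim : Tendsto (fun n => 2 * M * (√E / √(e n))) atTop (𝓝 (2 * M * 0)) :=
      ((Real.tendsto_sqrt_atTop.comp hetop).const_div_atTop (√E)).const_mul _
    rw [mul_zero] at hlim
    obtain ⟨n, hn, hn0⟩ := ((hlim.eventually_lt_const (show 0 < ε / 4 by positivity)).and
      (hetop.eventually_gt_atTop 0)).exists
    have hsum : Tendsto (fun X : H →L[ℂ] H => ∑ k ∈ Finset.range n, ‖(X - A) (τ k)‖) l (𝓝 0) := by
      rw [← Finset.sum_const_zero (s := Finset.range n)]
      exact tendsto_finsetSum _ fun k _ => tendsto_iff_norm_sub_tendsto_zero.1 (hs (τ k))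
    filter_upwards [hXA, hsum.eventually_lt_const (show 0 < ε / 4 by positivity)] with X hX hX'
    rw [Real.dist_eq, sub_zero, abs_of_nonneg (apply_nonneg _ _)]
    refine (eNorm_le_of_forall hE.le (half_pos hε).le fun x z hxz hx hz => ?_).trans_lt
      (half_lt_self hε)
    have h1 := hG.norm_apply_le_sum_add τ he hgr hn0 (X - A) hxz
    have h2 : ‖X - A‖ * (‖z‖ / √(e n)) ≤ 2 * M * (√E / √(e n)) := by gcongr
    rw [hx, one_mul] at h1
    linarith

/-- The complements of the projections onto finite-dimensional subspaces tend strongly to zero, so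
they tend to zero in the energy norm, that is, uniformly on vectors of bounded energy. Hence `1`
is a uniform limit of finite rank operators there, and `B = (1 + G)⁻¹` is a limit in norm of
operators of finite rank. -/
theorem isCompactOperator_resolvent (hG : IsPositiveSelfAdjoint G)
    (hinf : IsGLB {r : ℝ | ∃ φ : G.domain, ‖(φ : H)‖ = 1 ∧ r = ‖G φ‖} 0) (hE : 0 < E)
    (hgen : GeneratesSOTOnBounded (eNorm G E)) {B : H →L[ℂ] H}
    (hB : ∀ x y : H, (x, y) ∈ G.graph ↔ x = B (x + y)) : IsCompactOperator B := by
  obtain ⟨C, hC, hCle⟩ := exists_norm_apply_le_graph_norm_mul_eNorm hG hinf hE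
  let U : Finset H → Submodule ℂ H := fun F => Submodule.span ℂ (F : Set H)
  have hU : Monotone U := fun F F' h => Submodule.span_mono (by exact_mod_cast h)
  have hUtop : ⊤ ≤ (⨆ F, U F).topologicalClosure := by
    refine le_trans (fun x _ => ?_) (Submodule.le_topologicalClosure _)
    exact Submodule.mem_iSup_of_mem {x} (Submodule.subset_span (by simp))
  let R : Finset H → (H →L[ℂ] H) := fun F => 1 - (U F).starProjection
  have hR : ∀ F, ‖R F‖ ≤ 1 + 1 := fun F =>
    (norm_sub_le _ _).trans (add_le_add ContinuousLinearMap.norm_id_le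
      (Submodule.starProjection_norm_le _))
  have hp : Tendsto (fun F => eNorm G E (R F)) atTop (𝓝 0) := by
    have h := ((generatesSOTOnBounded_iff _).1 hgen (Metric.closedBall 0 (1 + 1))
      Metric.isBounded_closedBall 0 (by simp) (Filter.map R atTop) ?_).2 ?_
    · simpa [Function.comp_def] using tendsto_map'_iff.1 h
    · exact Filter.mem_map.2 (Filter.Eventually.of_forall fun F => by simpa using hR F)
    · intro x
      refine tendsto_map'_iff.2 ?_
      have h := (tendsto_const_nhds (x := x)).sub (Submodule.starProjection_tendsto_self U hU x hUtop)
      rw [sub_self] at h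
      exact h
  obtain ⟨K, hK, hKle⟩ : ∃ K : ℝ, 0 < K ∧ ∀ (A : H →L[ℂ] H) (u : H),
      ‖A (B u)‖ ≤ K * eNorm G E A * ‖u‖ := by
    refine ⟨C * (‖B‖ + (1 + ‖B‖)), by positivity, fun A u => ?_⟩
    have hgr : (B u, u - B u) ∈ G.graph := (hB _ _).2 (by rw [add_sub_cancel])
    obtain ⟨z, hz, -, hz2⟩ := hG.exists_sqrtOp_graph hgr
    have h1 : ‖B u‖ ≤ ‖B‖ * ‖u‖ := B.le_opNorm u
    have h2 : ‖u - B u‖ ≤ ‖u‖ + ‖B u‖ := norm_sub_le _ _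
    have h3 : (⟪B u, u - B u⟫_ℂ).re ≤ ‖B u‖ * ‖u - B u‖ := re_inner_le_norm (𝕜 := ℂ) _ _
    have h4 : ‖z‖ ≤ (1 + ‖B‖) * ‖u‖ := by
      refine abs_le_of_sq_le_sq' ?_ (by positivity) |>.2
      have h5 : ‖B u‖ ≤ (1 + ‖B‖) * ‖u‖ := by linarith [norm_nonneg u]
      have h6 : ‖u - B u‖ ≤ (1 + ‖B‖) * ‖u‖ := by linarith
      rw [hz2, sq]
      exact h3.trans (mul_le_mul h5 h6 (norm_nonneg _) (by positivity))
    calc ‖A (B u)‖ ≤ C * (‖B u‖ + ‖z‖) * eNorm G E A := hCle A _ _ hz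
      _ ≤ C * (‖B‖ * ‖u‖ + (1 + ‖B‖) * ‖u‖) * eNorm G E A := by gcongr
      _ = _ := by ring
  have hlim : Tendsto (fun F => (U F).starProjection * B) atTop (𝓝 B) := by
    rw [tendsto_iff_norm_sub_tendsto_zero]
    have h0 := hp.const_mul K
    rw [mul_zero] at h0
    refine squeeze_zero (fun _ => norm_nonneg _) (fun F => ?_) h0
    rw [norm_sub_rev]
    exact ContinuousLinearMap.opNorm_le_bound _ (mul_nonneg hK.le (apply_nonneg _ _))
      fun u => hKle (R F) u
  refine isClosed_setOfPred_isCompactOperator.mem_of_tendsto hlim (Eventually.of_forall fun F => ?_)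
  have : ProperSpace (U F) := FiniteDimensional.proper ℂ _
  have h1 : IsCompactOperator (U F).subtypeL :=
    isCompactOperator_of_locallyCompactSpace_rng _
  exact h1.comp_clm ((U F).orthogonalProjectionOnto ∘L B)

end discrete

/-! ### Eigenbases of compact resolvents -/

section spectral

open Filter Topology

/-- A family of real numbers with finite sublevel sets can be enumerated in nondecreasing order. -/
theorem exists_equiv_nat_monotone {ι : Type*} [Infinite ι] (f : ι → ℝ)
    (hf : ∀ M, {i | f i ≤ M}.Finite) :
    ∃ σ : ℕ ≃ ι, Monotone (f ∘ σ) ∧ Tendsto (f ∘ σ) atTop atTop := by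
  classical
  have hcount : Countable ι := by
    rw [← Set.countable_univ_iff]
    refine (Set.countable_iUnion fun n : ℕ => (hf n).countable).mono fun i _ => ?_
    exact Set.mem_iUnion.2 (exists_nat_ge (f i))
  obtain ⟨g, hg⟩ := hcount.exists_injective_nat
  -- ties between equal values of `f` are broken by `g`
  let key : ι → ℝ ×ₗ ℕ := fun i => toLex (f i, g i)
  have hkey : Function.Injective key := fun i j h => hg (congrArg (fun p => (ofLex p).2) h)
  have hfle : ∀ {i j}, key i ≤ key j → f i ≤ f j := fun {i j} h => by
    rcases Prod.Lex.le_iff.1 h with h | h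
    · exact h.le
    · exact h.1.le
  have hfin : ∀ i, {j | key j < key i}.Finite := fun i =>
    (hf (f i)).subset fun j hj => hfle (le_of_lt hj)
  let r : ι → ℕ := fun i => {j | key j < key i}.ncard
  have hr : ∀ {i j}, key i < key j → r i < r j := fun {i j} h =>
    Set.ncard_lt_ncard ⟨fun k hk => lt_trans hk h, fun hsub => lt_irrefl (key i) (hsub h)⟩ (hfin j)
  have hrinj : Function.Injective r := fun i j h => by
    by_contra hne
    rcases lt_or_gt_of_ne (hkey.ne hne) with hlt | hlt
    · exact (hr hlt).ne h
    · exact (hr hlt).ne h.symm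
  have : Infinite (Set.range r) := (Set.infinite_range_of_injective hrinj).to_subtype
  let o : ℕ ≃o Set.range r := Nat.Subtype.orderIsoOfNat (Set.range r)
  let σ : ℕ ≃ ι := o.toEquiv.trans (Equiv.ofInjective r hrinj).symm
  have hσ : ∀ n, r (σ n) = o n := fun n => Equiv.apply_ofInjective_symm hrinj (o n)
  refine ⟨σ, fun m n hmn => hfle ?_, ?_⟩
  · by_contra! hlt
    have h1 := hr hlt
    rw [hσ, hσ] at h1
    exact absurd (o.monotone hmn) (not_le.2 h1)
  · rw [← Nat.cofinite_eq_atTop]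
    refine tendsto_atTop.2 fun M => ?_
    have h1 : {n | f (σ n) ≤ M}.Finite := (hf M).preimage σ.injective.injOn
    filter_upwards [h1.compl_mem_cofinite] with n hn
    exact le_of_not_ge hn

/-- The spectral theorem for compact self-adjoint operators, in the form of an eigenbasis. -/
theorem exists_hilbertBasis_eigenvectors.{u} {H : Type u} [NormedAddCommGroup H]
    [InnerProductSpace ℂ H] [CompleteSpace H] {B : H →L[ℂ] H} (hB : IsCompactOperator B)
    (hs : (B : H →ₗ[ℂ] H).IsSymmetric) :
    ∃ (ι : Type u) (b : HilbertBasis ι ℂ H) (μ : ι → ℂ), ∀ i, B (b i) = μ i • b i := by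
  let V : ℂ → Submodule ℂ H := fun μ => Module.End.eigenspace (B : Module.End ℂ H) μ
  have hcl : ∀ μ, CompleteSpace (V μ) := fun μ => by
    have : IsClosed (V μ : Set H) := by
      have h1 : (V μ : Set H) = {x | B x = μ • x} := by
        ext x
        exact Module.End.mem_eigenspace_iff
      rw [h1]
      exact isClosed_eq (by fun_prop) (by fun_prop)
    exact this.completeSpace_coe
  choose w c hc using fun μ => exists_hilbertBasis ℂ (V μ)
  have hon : Orthonormal ℂ fun a : Σ μ, w μ => ((c a.1 a.2 : V a.1) : H) :=
    hs.orthogonalFamily_eigenspaces.orthonormal_sigma_orthonormal fun μ => (c μ).orthonormal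
  have hbot : (Submodule.span ℂ (Set.range fun a : Σ μ, w μ => ((c a.1 a.2 : V a.1) : H)))ᗮ = ⊥ := by
    rw [← ContinuousLinearMap.orthogonalComplement_iSup_eigenspaces_eq_bot hB hs]
    refine le_antisymm ?_ (Submodule.orthogonal_le ?_)
    · rw [← Submodule.orthogonal_closure]
      refine Submodule.orthogonal_le (iSup_le fun μ x hx => ?_)
      have h1 := ((c μ).hasSum_repr ⟨x, hx⟩).mapL (V μ).subtypeL
      refine Submodule.isClosed_topologicalClosure _ |>.mem_of_tendsto h1 (Eventually.of_forall ?_)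
      intro s
      refine Submodule.sum_mem _ fun k _ => ?_
      rw [map_smul]
      exact Submodule.smul_mem _ _ (Submodule.le_topologicalClosure _
        (Submodule.subset_span ⟨⟨μ, k⟩, rfl⟩))
    · rw [Submodule.span_le]
      rintro _ ⟨a, rfl⟩
      exact Submodule.mem_iSup_of_mem a.1 (c a.1 a.2).2
  refine ⟨Σ μ, w μ, HilbertBasis.mkOfOrthogonalEqBot hon hbot, fun a => a.1, fun a => ?_⟩
  rw [HilbertBasis.coe_mkOfOrthogonalEqBot]
  exact Module.End.mem_eigenspace_iff.1 (c a.1 a.2).2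

omit [CompleteSpace H] in
/-- Otherwise the images under `B` of infinitely many of the `v i` would be at mutual distance at
least `ε`, inside a compact set. -/
theorem finite_setOf_le_eigenvalue {B : H →L[ℂ] H} (hB : IsCompactOperator B) {ι : Type*}
    {v : ι → H} (hv : Orthonormal ℂ v) {r : ι → ℝ} (hr : ∀ i, B (v i) = (r i : ℂ) • v i)
    {ε : ℝ} (hε : 0 < ε) : {i | ε ≤ r i}.Finite := by
  by_contra hinf
  let f : ℕ → ι := fun n => (Set.Infinite.natEmbedding _ hinf n : ι)
  have hf : Function.Injective f :=
    Subtype.val_injective.comp (Set.Infinite.natEmbedding _ hinf).injective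
  have hfr : ∀ n, ε ≤ r (f n) := fun n => (Set.Infinite.natEmbedding _ hinf n).2
  obtain ⟨K, hK, hKsub⟩ := hB.image_closedBall_subset_compact (f := (B : H →ₗ[ℂ] H)) 1
  have hmem : ∀ n, B (v (f n)) ∈ K := fun n =>
    hKsub ⟨v (f n), by simp [hv.1 (f n)], rfl⟩
  obtain ⟨a, -, φ, hφ, hlim⟩ := hK.tendsto_subseq hmem
  have hdist : Tendsto (fun n => dist (B (v (f (φ n)))) (B (v (f (φ (n + 1)))))) atTop (𝓝 0) := by
    have := hlim.dist (hlim.comp (tendsto_add_atTop_nat 1))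
    rwa [dist_self] at this
  obtain ⟨n, hn⟩ := (hdist.eventually_lt_const hε).exists
  have hne : f (φ n) ≠ f (φ (n + 1)) := hf.ne (hφ (Nat.lt_succ_self n)).ne
  rw [dist_eq_norm, hr, hr] at hn
  have horth : ⟪(r (f (φ n)) : ℂ) • v (f (φ n)), (r (f (φ (n + 1))) : ℂ) • v (f (φ (n + 1)))⟫_ℂ
      = 0 := by
    rw [inner_smul_left, inner_smul_right, hv.2 hne, mul_zero, mul_zero]
  have hpyth := norm_sub_sq (𝕜 := ℂ) ((r (f (φ n)) : ℂ) • v (f (φ n)))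
    ((r (f (φ (n + 1))) : ℂ) • v (f (φ (n + 1))))
  rw [horth, map_zero, mul_zero, sub_zero] at hpyth
  have h1 := hfr (φ n)
  have h2 : ‖(r (f (φ n)) : ℂ) • v (f (φ n))‖ = r (f (φ n)) := by
    rw [norm_smul, hv.1, Complex.norm_real, Real.norm_eq_abs, abs_of_pos (hε.trans_le h1), mul_one]
  rw [h2] at hpyth
  nlinarith [norm_nonneg ((r (f (φ n)) : ℂ) • v (f (φ n)) -
    (r (f (φ (n + 1))) : ℂ) • v (f (φ (n + 1)))), sq_nonneg ‖(r (f (φ (n + 1))) : ℂ) • v (f (φ (n + 1)))‖]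

/-- Here `B` stands for `(1 + G)⁻¹`: an eigenvalue `r` of `B` corresponds to the eigenvalue
`r⁻¹ - 1` of `G`, and the latter tend to infinity since those of `B` tend to zero. -/
theorem isDiscreteOp_of_isCompactOperator_resolvent (hH : ¬ FiniteDimensional ℂ H)
    {G : H →ₗ.[ℂ] H} {B : H →L[ℂ] H} (hpos : B.IsPositive) (hinj : Function.Injective B)
    (hB : ∀ x y : H, (x, y) ∈ G.graph ↔ x = B (x + y)) (hc : IsCompactOperator B) :
    IsDiscreteOp G := by
  obtain ⟨ι, b, μ, hμ⟩ := exists_hilbertBasis_eigenvectors hc hpos.isSymmetric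
  have hb1 : ∀ i, ‖b i‖ = 1 := b.orthonormal.1
  have hμr : ∀ i, 0 < (μ i).re ∧ μ i = ((μ i).re : ℂ) := by
    intro i
    have h1 := hpos.inner_nonneg_right (b i)
    rw [hμ, inner_smul_right, inner_self_eq_norm_sq_to_K, hb1] at h1
    simp only [Complex.coe_algebraMap, Complex.ofReal_one, one_pow, mul_one] at h1
    obtain ⟨h2, h3⟩ := Complex.nonneg_iff.1 h1
    have h4 : μ i = ((μ i).re : ℂ) := Complex.ext rfl h3.symm
    refine ⟨h2.lt_of_ne fun h0 => ?_, h4⟩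
    rw [← h0, Complex.ofReal_zero] at h4
    have h5 := hμ i
    rw [h4, zero_smul] at h5
    have h6 : b i = 0 := hinj (h5.trans (map_zero B).symm)
    simpa [h6] using hb1 i
  let r : ι → ℝ := fun i => (μ i).re
  have hr0 : ∀ i, 0 < r i := fun i => (hμr i).1
  have hr : ∀ i, B (b i) = (r i : ℂ) • b i := fun i => by rw [hμ, (hμr i).2]
  have hι : Infinite ι := by
    by_contra hfin
    have : Finite ι := not_infinite_iff_finite.1 hfin
    have := Fintype.ofFinite ι
    exact hH b.toOrthonormalBasis.toBasis.finiteDimensional_of_finite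
  obtain ⟨σ, hmono, htop⟩ := exists_equiv_nat_monotone (fun i => (r i)⁻¹ - 1) fun M => by
    refine (finite_setOf_le_eigenvalue hc b.orthonormal hr
      (show 0 < (|M| + 1)⁻¹ by positivity)).subset fun i hi => ?_
    have h1 : (r i)⁻¹ ≤ |M| + 1 := by
      have h2 : (r i)⁻¹ - 1 ≤ M := hi
      linarith [le_abs_self M]
    exact inv_le_of_inv_le₀ (hr0 i) h1
  have hbon : Orthonormal ℂ (b ∘ σ) := b.orthonormal.comp σ σ.injective
  let τ : HilbertBasis ℕ ℂ H := HilbertBasis.mk hbon (by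
    rw [σ.surjective.range_comp]
    exact b.dense_span.ge)
  have hτ : ∀ k, τ k = b (σ k) := fun k => by
    rw [show ⇑τ = b ∘ σ from HilbertBasis.coe_mk _ _]
    rfl
  let e : ℕ → ℝ := fun k => (r (σ k))⁻¹ - 1
  have hBτ : ∀ k x, ⟪τ k, B x⟫_ℂ = (r (σ k) : ℂ) * ⟪τ k, x⟫_ℂ := fun k x => by
    rw [← hpos.inner_left_eq_inner_right, hτ, hr, inner_smul_left, Complex.conj_ofReal]
  have hrC : ∀ k, (r (σ k) : ℂ) ≠ 0 := fun k => Complex.ofReal_ne_zero.2 (hr0 _).ne'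
  -- in the coordinates of the eigenbasis, `x = B (x + y)` reads `y k = e k * x k`
  have hcoef : ∀ x y : H, (x, y) ∈ G.graph ↔
      ∀ k, ⟪τ k, y⟫_ℂ = (e k : ℂ) * ⟪τ k, x⟫_ℂ := by
    intro x y
    have h1 : x = B (x + y) ↔ ∀ k, ⟪τ k, x⟫_ℂ = ⟪τ k, B (x + y)⟫_ℂ := by
      refine ⟨fun h k => by rw [← h], fun h => τ.repr.injective ?_⟩
      ext k
      rw [τ.repr_apply_apply, τ.repr_apply_apply, h]
    rw [hB, h1]
    refine forall_congr' fun k => ?_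
    have h2 : (e k : ℂ) = (r (σ k) : ℂ)⁻¹ - 1 := by simp [e]
    rw [hBτ, inner_add_right, h2]
    have h3 := hrC k
    constructor
    · intro h
      field_simp
      linear_combination -h
    · intro h
      rw [h]
      field_simp
      ring
  have hsq : ∀ k (x : H), ‖(e k : ℂ) * ⟪τ k, x⟫_ℂ‖ ^ 2 = e k ^ 2 * ‖⟪τ k, x⟫_ℂ‖ ^ 2 := by
    intro k x
    rw [norm_mul, mul_pow, Complex.norm_real, Real.norm_eq_abs, sq_abs]
  refine ⟨τ, e, hmono, htop, fun x => ⟨fun hx => ?_, fun hx => ?_⟩, fun x => ?_⟩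
  · have h1 := (hcoef _ _).1 (G.mem_graph ⟨x, hx⟩)
    refine (hasSum_norm_inner_sq τ (G ⟨x, hx⟩)).summable.congr fun k => ?_
    rw [h1, hsq]
  · have hmem : Memℓp (fun k => (e k : ℂ) * ⟪τ k, x⟫_ℂ) 2 := by
      refine memℓp_gen (hx.congr fun k => ?_)
      rw [← hsq]
      simp
    have h1 : (x, τ.repr.symm ⟨_, hmem⟩) ∈ G.graph := (hcoef _ _).2 fun k => by
      rw [← τ.repr_apply_apply, LinearIsometryEquiv.apply_symm_apply]
    exact LinearPMap.mem_domain_of_mem_graph h1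
  · have h1 := (hcoef _ _).1 (G.mem_graph x)
    have h2 := τ.hasSum_repr (G x)
    simp_rw [τ.repr_apply_apply, h1] at h2
    exact h2

omit [CompleteSpace H] in
theorem IsDiscreteOp.not_isBoundedOp {G : H →ₗ.[ℂ] H} (hd : IsDiscreteOp G) :
    ¬ IsBoundedOp G := by
  rintro ⟨C, hC⟩
  obtain ⟨τ, e, -, htop, hdom, hG⟩ := hd
  obtain ⟨n, hn⟩ := (htop.eventually_gt_atTop C).exists
  obtain ⟨u, hu, hu'⟩ := (LinearPMap.mem_graph_iff G).1 (mem_graph_basis hdom hG n)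
  have h1 := hC u
  simp only at hu hu'
  rw [hu', hu, norm_smul, τ.orthonormal.1, mul_one, mul_one, Complex.norm_real] at h1
  exact absurd ((le_abs_self _).trans h1) (not_le.2 hn)

end spectral

end OperatorENorm

theorem proposition2 {H : Type*} [NormedAddCommGroup H] [InnerProductSpace ℂ H] [CompleteSpace H]
    [TopologicalSpace.SeparableSpace H] (hH : ¬ FiniteDimensional ℂ H)
    (G : H →ₗ.[ℂ] H) (hG : OperatorENorm.IsPositiveSelfAdjoint G)
    (hinf : IsGLB {r : ℝ | ∃ φ : G.domain, ‖(φ : H)‖ = 1 ∧ r = ‖G φ‖} 0)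
    (E : ℝ) (hE : 0 < E) :
    (OperatorENorm.EquivOpNorm (OperatorENorm.eNorm G E) ↔ OperatorENorm.IsBoundedOp G) ∧
    (OperatorENorm.GeneratesSOTOnBounded (OperatorENorm.eNorm G E) ↔
      (¬ OperatorENorm.IsBoundedOp G ∧ OperatorENorm.IsDiscreteOp G)) := by
  refine ⟨⟨OperatorENorm.isBoundedOp_of_equivOpNorm hG hE,
    OperatorENorm.equivOpNorm_of_isBoundedOp hG hinf hE⟩, fun hgen => ?_, fun hd =>
    OperatorENorm.generatesSOTOnBounded_of_isDiscreteOp hG hinf hE hd.2⟩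
  obtain ⟨B, hpos, -, hinj, hB⟩ := hG.exists_resolvent
  have hd : OperatorENorm.IsDiscreteOp G :=
    OperatorENorm.isDiscreteOp_of_isCompactOperator_resolvent hH hpos hinj hB
      (OperatorENorm.isCompactOperator_resolvent hG hinf hE hgen hB)
  exact ⟨hd.not_isBoundedOp, hd⟩
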